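/- Let $m,n,d$ be nonnegative integers, let $H^{1/2}\in\mathbb{R}^{n\times d}$ be a fixed matrix of full column rank, $H=(H^{1/2})^TH^{1/2}$, and let $g\in\mathbb{R}^d$. Let $S\in\mathbb{R}^{m\times n}$ be a Gaussian sketch, i.e. a random matrix whose entries are i.i.d. normal with mean $0$ and variance $1/m$. For $\alpha_s\in\mathbb{R}$ put $$\Delta^*=H^{-1}g,\qquad \hat\Delta=\alpha_s\big((H^{1/2})^TS^TSH^{1/2}\big)^{-1}g,$$ $$\theta_1=\frac{m}{m-d-1},\qquad \theta_2=\frac{m^2(m-1)}{(m-d)(m-d-1)(m-d-3)}.$$ (1) If $m>d+1$, then $H^{1/2}(\hat\Delta-\Delta^*)$ is integrable for every $\alpha_s$, and the bias $\mathbb{E}[H^{1/2}(\hat\Delta-\Delta^*)]$ is zero for $\alpha_s=1/\theta_1$; if moreover $g\neq 0$, it is zero only for this value of $\alpha_s$. (2) If $m>d+3$, then the variance $\mathbb{E}\big[\|H^{1/2}(\hat\Delta-\Delta^*)\|_2^2\big]$ is finite for every $\alpha_s$, and over all $\alpha_s\in\mathbb{R}$ it is minimized at $\alpha_s=\theta_1/\theta_2$;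 if moreover $g\neq 0$, this is the only minimizer. -/

import Mathlib

open MeasureTheory ProbabilityTheory
open scoped NNReal Matrix

noncomputable section

namespace NewtonSketch

/-- A random `m × n` matrix is a Gaussian sketch if its entries are i.i.d. with the normal law
of mean `0` and variance `1 / m`. -/
structure IsGaussianSketch {Ω : Type*} [MeasurableSpace Ω] {m n : ℕ}
    (S : Ω → Matrix (Fin m) (Fin n) ℝ) (P : Measure Ω) : Prop where
  hasLaw_entry : ∀ (i : Fin m) (j : Fin n),
    HasLaw (fun ω => S ω i j) (gaussianReal 0 (1 / (m : ℝ≥0))) P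
  indep_entries : iIndepFun (fun (p : Fin m × Fin n) (ω : Ω) => S ω p.1 p.2) P

/-- `θ₁ = m / (m - d - 1)`. -/
def theta1 (m d : ℕ) : ℝ := (m : ℝ) / ((m : ℝ) - d - 1)

/-- `θ₂ = m² (m - 1) / ((m - d) (m - d - 1) (m - d - 3))`. -/
def theta2 (m d : ℕ) : ℝ :=
  (m : ℝ) ^ 2 * ((m : ℝ) - 1) / (((m : ℝ) - d) * ((m : ℝ) - d - 1) * ((m : ℝ) - d - 3))

/-- The optimal Newton direction `Δ* = (Aᵀ A)⁻¹ g`, where `A = H^{1/2}`. -/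
def newtonDirection {n d : ℕ} (A : Matrix (Fin n) (Fin d) ℝ) (g : Fin d → ℝ) : Fin d → ℝ :=
  (Aᵀ * A)⁻¹ *ᵥ g

/-- The sketched Newton direction `Δ̂ = α (Aᵀ Sᵀ S A)⁻¹ g`, where `A = H^{1/2}`. -/
def sketchedDirection {m n d : ℕ} (A : Matrix (Fin n) (Fin d) ℝ) (g : Fin d → ℝ)
    (S : Matrix (Fin m) (Fin n) ℝ) (α : ℝ) : Fin d → ℝ :=
  α • ((Aᵀ * Sᵀ * S * A)⁻¹ *ᵥ g)

/-- The error vector `A (Δ̂ - Δ*)`, with the Euclidean norm, where `A = H^{1/2}`. -/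
def directionError {m n d : ℕ} (A : Matrix (Fin n) (Fin d) ℝ) (g : Fin d → ℝ)
    (S : Matrix (Fin m) (Fin n) ℝ) (α : ℝ) : EuclideanSpace ℝ (Fin n) :=
  WithLp.toLp 2 (A *ᵥ (sketchedDirection A g S α - newtonDirection A g))

variable {Ω : Type*} [MeasurableSpace Ω] {m n d : ℕ}

/-- The bias `E[A (Δ̂ - Δ*)]`. -/
def bias (P : Measure Ω) (S : Ω → Matrix (Fin m) (Fin n) ℝ)
    (A : Matrix (Fin n) (Fin d) ℝ) (g : Fin d → ℝ) (α : ℝ) : EuclideanSpace ℝ (Fin n) :=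
  ∫ ω, directionError A g (S ω) α ∂P

/-- The variance `E[‖A (Δ̂ - Δ*)‖²]`. -/
def errorVariance (P : Measure Ω) (S : Ω → Matrix (Fin m) (Fin n) ℝ)
    (A : Matrix (Fin n) (Fin d) ℝ) (g : Fin d → ℝ) (α : ℝ) : ℝ :=
  ∫ ω, ‖directionError A g (S ω) α‖ ^ 2 ∂P

end NewtonSketch

end

/-!
Write `A = Bᵀ R` with `R` invertible and the rows of `B` an orthonormal basis of the range of `A`
whose first vector is parallel to `A (Aᵀ A)⁻¹ g`. With `W` the Gram matrix of the vectors
`S *ᵥ B j`, the error is `c Bᵀ (α W⁻¹ - 1) e₀` for a nonzero constant `c`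
(`exists_directionError_eq`), and by rotation invariance of the normal law these vectors are i.i.d.
with i.i.d. normal entries (`IsGaussianSketch.hasLaw_mulVec`). Hence everything follows from
`E[W⁻¹ e₀] = θ₁ e₀` and `E[‖W⁻¹ e₀‖²] = θ₂`: the bias is a nonzero vector times `α θ₁ - 1`, and the
variance a positive multiple of `α² θ₂ - 2 α θ₁ + 1`.

For these moments of the inverse Wishart matrix, condition on all the vectors but one. In
coordinates adapted to the span of the others, the remaining vector consists of two independent
Gaussian vectors `a` (in the span) and `b` (orthogonal to it), and block inversion expresses its
column of `W⁻¹` as `1 / |b|²` on the diagonal and `-(T⁻ᵀ a) / |b|²` off the diagonal, where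
`T Tᵀ` is the Gram matrix of the other vectors (`inv_gram_insertNth`). The diagonal entries need
only `E[|b|⁻²]` (`lintegral_inv_gram_diag`). The second moment of the column is `E[|b|⁻⁴]` times
`1 + v E[tr (T Tᵀ)⁻¹]`, and the trace is a sum of diagonal entries for one vector fewer
(`lintegral_sum_inv_gram_sq`). The off-diagonal entries have mean zero, since changing the sign of
one vector preserves the law (`integral_inv_gram_off_diag`). The negative moments of `|b|²` come
from `s⁻ⁿ⁻¹ = (1 / n!) ∫ tⁿ exp (-t s) dt` and the Laplace transform
`E[exp (-t |b|²)] = (1 + 2 v t) ^ (-k / 2)`. All of these are computed as integrals with values in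
`[0, ∞]`, so that integrability comes with the value.
-/

namespace NewtonSketch

/-! ### Negative moments of a Gaussian vector -/

/-- The law of a vector with i.i.d. centred normal entries of variance `v`. -/
noncomputable abbrev gaussianVector (ι : Type*) [Fintype ι] (v : ℝ≥0) : Measure (ι → ℝ) :=
  Measure.pi fun _ => gaussianReal 0 v

theorem integral_exp_neg_mul_sq_gaussianReal {v : ℝ≥0} (hv : v ≠ 0) {t : ℝ} (ht : 0 ≤ t) :
    ∫ x, Real.exp (-(t * x ^ 2)) ∂gaussianReal 0 v = (1 + 2 * v * t) ^ (-(1 / 2) : ℝ) := by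
  have hv0 : (0 : ℝ) < v := by positivity
  rw [integral_gaussianReal_eq_integral_smul hv]
  have h (x : ℝ) : gaussianPDFReal 0 v x • Real.exp (-(t * x ^ 2))
      = (√(2 * Real.pi * v))⁻¹ * Real.exp (-(t + 1 / (2 * v)) * x ^ 2) := by
    rw [gaussianPDFReal, smul_eq_mul, mul_assoc, ← Real.exp_add]
    congr 2
    field_simp
    ring
  simp_rw [h]
  rw [integral_const_mul, integral_gaussian, Real.rpow_neg (by positivity), ← Real.sqrt_eq_rpow,
    ← Real.sqrt_inv, ← Real.sqrt_inv, ← Real.sqrt_mul (by positivity)]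
  congr 1
  field_simp
  ring

theorem lintegral_exp_neg_mul_dotProduct_gaussianVector {v : ℝ≥0} (hv : v ≠ 0) (k : ℕ) {t : ℝ}
    (ht : 0 ≤ t) :
    ∫⁻ x, ENNReal.ofReal (Real.exp (-(t * (x ⬝ᵥ x)))) ∂gaussianVector (Fin k) v
      = ENNReal.ofReal ((1 + 2 * v * t) ^ (-(k / 2) : ℝ)) := by
  rw [← ofReal_integral_eq_lintegral_ofReal]
  · have h (x : Fin k → ℝ) :
        Real.exp (-(t * (x ⬝ᵥ x))) = ∏ i, Real.exp (-(t * x i ^ 2)) := by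
      rw [← Real.exp_sum, dotProduct, Finset.mul_sum, ← Finset.sum_neg_distrib]
      simp_rw [pow_two]
    simp_rw [h]
    rw [integral_fintype_prod_eq_prod (fun _ x => Real.exp (-(t * x ^ 2)))]
    simp_rw [integral_exp_neg_mul_sq_gaussianReal hv ht]
    rw [Finset.prod_const, Finset.card_univ, Fintype.card_fin, ← Real.rpow_mul_natCast
      (by positivity)]
    congr 2
    ring
  · refine Integrable.of_bound (C := 1) (by fun_prop) (ae_of_all _ fun x => ?_)
    rw [Real.norm_eq_abs, Real.abs_exp, Real.exp_le_one_iff, neg_nonpos]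
    exact mul_nonneg ht (Finset.sum_nonneg fun i _ => mul_self_nonneg _)
  · exact ae_of_all _ fun x => (Real.exp_pos _).le

theorem lintegral_pow_mul_exp_neg_mul_Ioi (n : ℕ) {s : ℝ} (hs : 0 < s) :
    ∫⁻ t in Set.Ioi 0, ENNReal.ofReal (t ^ n * Real.exp (-(t * s)))
      = ENNReal.ofReal (n.factorial / s ^ (n + 1)) := by
  have h := Real.integral_rpow_mul_exp_neg_mul_Ioi (a := n + 1) (by positivity) hs
  have h' : ∫ t in Set.Ioi 0, t ^ n * Real.exp (-(t * s)) = n.factorial / s ^ (n + 1) := by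
    rw [Real.Gamma_nat_eq_factorial, ← Nat.cast_add_one, Real.rpow_natCast] at h
    calc _ = _ := ?_
      _ = _ := h
      _ = _ := by rw [one_div, inv_pow]; ring
    simp [mul_comm s]
  rw [← h', ofReal_integral_eq_lintegral_ofReal]
  -- The value of the integral is not zero, so it is not the junk value of a divergent one.
  · by_contra hcon
    rw [integral_undef hcon] at h'
    have : 0 < n.factorial / s ^ (n + 1) := by positivity
    exact this.ne h'
  · filter_upwards [ae_restrict_mem measurableSet_Ioi] with t ht
    have : (0 : ℝ) < t := ht
    positivity

theorem integral_one_add_mul_rpow_neg_Ioi {c p : ℝ} (hc : 0 < c) (hp : 1 < p) :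
    IntegrableOn (fun t : ℝ => (1 + c * t) ^ (-p)) (Set.Ioi 0) ∧
    ∫ t in Set.Ioi 0, (1 + c * t) ^ (-p) = 1 / (c * (p - 1)) := by
  have hd : ∀ t ∈ Set.Ici (0 : ℝ),
      HasDerivAt (fun t : ℝ => -(1 / (c * (p - 1))) * (1 + c * t) ^ (1 - p))
        ((1 + c * t) ^ (-p)) t := by
    intro t ht
    have ht' : (0 : ℝ) ≤ t := ht
    have h1 : HasDerivAt (fun t : ℝ => 1 + c * t) c t := by
      simpa using ((hasDerivAt_id t).const_mul c).const_add 1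
    convert! (h1.rpow_const (p := 1 - p) (Or.inl (by positivity))).const_mul
      (-(1 / (c * (p - 1)))) using 1
    have : p - 1 ≠ 0 := by linarith
    rw [show 1 - p - 1 = -p by ring]
    field_simp
    ring
  have hl : Filter.Tendsto (fun t : ℝ => -(1 / (c * (p - 1))) * (1 + c * t) ^ (1 - p))
      Filter.atTop (nhds 0) := by
    have h1 : Filter.Tendsto (fun t : ℝ => 1 + c * t) Filter.atTop Filter.atTop :=
      Filter.tendsto_atTop_add_const_left _ _ (Filter.tendsto_id.const_mul_atTop hc)
    have h2 := (tendsto_rpow_neg_atTop (y := p - 1) (by linarith)).comp h1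
    simpa [Function.comp_def] using h2.const_mul (-(1 / (c * (p - 1))))
  have hn : ∀ t ∈ Set.Ioi (0 : ℝ), 0 ≤ (1 + c * t) ^ (-p) := by
    intro t ht
    have ht' : (0 : ℝ) < t := ht
    positivity
  refine ⟨integrableOn_Ioi_deriv_of_nonneg' hd hn hl, ?_⟩
  rw [integral_Ioi_of_hasDerivAt_of_nonneg' hd hn hl]
  simp

theorem gaussianVector_ae_dotProduct_self_pos {v : ℝ≥0} (hv : v ≠ 0) {k : ℕ} (hk : 0 < k) :
    ∀ᵐ x ∂gaussianVector (Fin k) v, 0 < x ⬝ᵥ x := by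
  have := nullSingletonClass_gaussianReal (μ := 0) hv
  have : Nonempty (Fin k) := ⟨⟨0, hk⟩⟩
  have h : ∀ᵐ x ∂gaussianVector (Fin k) v, x ≠ 0 := by
    rw [ae_iff]; simp
  filter_upwards [h] with x hx
  exact lt_of_le_of_ne (Finset.sum_nonneg fun i _ => mul_self_nonneg _)
    (fun h => hx (dotProduct_self_eq_zero.1 h.symm))

/-- The negative moments of the squared norm as integrals of its Laplace transform. -/
theorem lintegral_inv_pow_dotProduct_gaussianVector {v : ℝ≥0} (hv : v ≠ 0) {k : ℕ} (hk : 0 < k)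
    (n : ℕ) :
    ENNReal.ofReal n.factorial *
      ∫⁻ x, ENNReal.ofReal (1 / (x ⬝ᵥ x) ^ (n + 1)) ∂gaussianVector (Fin k) v
      = ∫⁻ t in Set.Ioi 0, ENNReal.ofReal (t ^ n * (1 + 2 * v * t) ^ (-(k / 2) : ℝ)) := by
  calc _ = ∫⁻ x : Fin k → ℝ,
          (∫⁻ t in Set.Ioi (0 : ℝ), ENNReal.ofReal (t ^ n * Real.exp (-(t * (x ⬝ᵥ x)))))
        ∂gaussianVector (Fin k) v := by
        rw [← lintegral_const_mul' _ _ ENNReal.ofReal_ne_top]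
        refine lintegral_congr_ae ?_
        filter_upwards [gaussianVector_ae_dotProduct_self_pos hv hk] with x hx
        rw [lintegral_pow_mul_exp_neg_mul_Ioi n hx, ← ENNReal.ofReal_mul (by positivity),
          mul_one_div]
    _ = ∫⁻ t in Set.Ioi (0 : ℝ), ∫⁻ x : Fin k → ℝ,
          ENNReal.ofReal (t ^ n * Real.exp (-(t * (x ⬝ᵥ x))))
        ∂gaussianVector (Fin k) v := by
        refine lintegral_lintegral_swap ?_
        unfold Function.uncurry dotProduct
        fun_prop
    _ = _ := by
        refine setLIntegral_congr_fun measurableSet_Ioi fun t ht => ?_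
        have ht' : (0 : ℝ) < t := ht
        simp_rw [ENNReal.ofReal_mul (pow_nonneg ht'.le n)]
        rw [lintegral_const_mul' _ _ ENNReal.ofReal_ne_top,
          lintegral_exp_neg_mul_dotProduct_gaussianVector hv k ht'.le]

theorem lintegral_inv_dotProduct_gaussianVector {v : ℝ≥0} (hv : v ≠ 0) {k : ℕ} (hk : 2 < k) :
    ∫⁻ x, ENNReal.ofReal (1 / (x ⬝ᵥ x)) ∂gaussianVector (Fin k) v
      = ENNReal.ofReal (1 / (v * (k - 2))) := by
  have hv0 : (0 : ℝ) < v := by positivity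
  have hk' : (2 : ℝ) < k := by exact_mod_cast hk
  have h := lintegral_inv_pow_dotProduct_gaussianVector hv (by omega : 0 < k) 0
  obtain ⟨h1, h2⟩ := integral_one_add_mul_rpow_neg_Ioi (c := 2 * v) (p := k / 2)
    (by positivity) (by linarith)
  simp only [Nat.factorial_zero, Nat.cast_one, ENNReal.ofReal_one, one_mul, zero_add, pow_one,
    pow_zero] at h
  rw [h, ← ofReal_integral_eq_lintegral_ofReal h1, h2]
  · congr 1
    field_simp
  · filter_upwards [ae_restrict_mem measurableSet_Ioi] with t ht
    have : (0 : ℝ) < t := ht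
    positivity

theorem lintegral_inv_sq_dotProduct_gaussianVector {v : ℝ≥0} (hv : v ≠ 0) {k : ℕ} (hk : 4 < k) :
    ∫⁻ x, ENNReal.ofReal (1 / (x ⬝ᵥ x) ^ 2) ∂gaussianVector (Fin k) v
      = ENNReal.ofReal (1 / (v ^ 2 * ((k - 2) * (k - 4)))) := by
  have hv0 : (0 : ℝ) < v := by positivity
  have hk' : (4 : ℝ) < k := by exact_mod_cast hk
  have h := lintegral_inv_pow_dotProduct_gaussianVector hv (by omega : 0 < k) 1
  obtain ⟨h1, h2⟩ := integral_one_add_mul_rpow_neg_Ioi (c := 2 * v) (p := k / 2)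
    (by positivity) (by linarith)
  obtain ⟨h3, h4⟩ := integral_one_add_mul_rpow_neg_Ioi (c := 2 * v) (p := k / 2 - 1)
    (by positivity) (by linarith)
  simp only [Nat.factorial_one, Nat.cast_one, ENNReal.ofReal_one, one_mul, pow_one] at h
  rw [h]
  -- `2 v t (1 + 2 v t) ^ (-p) = (1 + 2 v t) ^ (1 - p) - (1 + 2 v t) ^ (-p)`
  have hsplit : ∀ t ∈ Set.Ioi (0 : ℝ), t * (1 + 2 * v * t) ^ (-(k / 2) : ℝ)
      = 1 / (2 * v) *
        ((1 + 2 * v * t) ^ (-(k / 2 - 1) : ℝ) - (1 + 2 * v * t) ^ (-(k / 2) : ℝ)) := by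
    intro t ht
    have : (0 : ℝ) < t := ht
    rw [show (-(k / 2 - 1) : ℝ) = -(k / 2) + 1 by ring, Real.rpow_add_one (by positivity)]
    field_simp
    ring
  rw [setLIntegral_congr_fun measurableSet_Ioi (fun t ht => congrArg ENNReal.ofReal (hsplit t ht)),
    ← ofReal_integral_eq_lintegral_ofReal (by exact (h3.sub h1).const_mul _), integral_const_mul]
  · rw [integral_sub h3 h1, h2, h4]
    congr 1
    have : (k : ℝ) - 2 ≠ 0 := by linarith
    have : (k : ℝ) - 4 ≠ 0 := by linarith
    rw [show (k : ℝ) / 2 - 1 - 1 = (k - 4) / 2 by ring, show (k : ℝ) / 2 - 1 = (k - 2) / 2 by ring]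
    field_simp
    ring
  · filter_upwards [ae_restrict_mem measurableSet_Ioi] with t ht
    have h' : (0 : ℝ) < t := ht
    rw [Pi.zero_apply, ← hsplit t ht]
    positivity

/-! ### Rotation invariance of Gaussian vectors -/

theorem charFun_map_toLp_gaussianVector {ι : Type*} [Fintype ι] (v : ℝ≥0)
    (t : EuclideanSpace ℝ ι) :
    charFun ((gaussianVector ι v).map (WithLp.toLp 2)) t
      = Complex.exp (-((v : ℝ) * (t.ofLp ⬝ᵥ t.ofLp) / 2 : ℝ)) := by
  rw [charFun_pi]
  simp_rw [charFun_gaussianReal]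
  rw [← Complex.exp_sum]
  congr 1
  simp [dotProduct, Finset.mul_sum, Finset.sum_div, pow_two]

/-- Rotation invariance of the normal law, in the form of a coisometry: a matrix with orthonormal
rows maps a vector of i.i.d. centred normal entries to another such vector. -/
theorem map_mulVec_gaussianVector {ι κ : Type*} [Fintype ι] [Fintype κ] [DecidableEq κ]
    (v : ℝ≥0) (U : Matrix κ ι ℝ) (hU : U * Uᵀ = 1) :
    (gaussianVector ι v).map (fun x => U *ᵥ x) = gaussianVector κ v := by
  have hm : Measurable fun x : ι → ℝ => U *ᵥ x := by
    unfold Matrix.mulVec dotProduct; fun_prop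
  refine (MeasurableEquiv.toLp 2 (κ → ℝ)).map_measurableEquiv_injective ?_
  rw [MeasurableEquiv.coe_toLp]
  refine Measure.ext_of_charFun (E := EuclideanSpace ℝ κ) (funext fun t => ?_)
  rw [charFun_map_toLp_gaussianVector, Measure.map_map (by fun_prop) hm, charFun_apply,
    integral_map (by fun_prop) (by fun_prop)]
  have h := charFun_map_toLp_gaussianVector v (WithLp.toLp 2 (Uᵀ *ᵥ t.ofLp))
  rw [charFun_apply, integral_map (by fun_prop) (by fun_prop)] at h
  have e1 (x : ι → ℝ) : inner ℝ (WithLp.toLp 2 (U *ᵥ x)) t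
      = inner ℝ (WithLp.toLp 2 x) (WithLp.toLp 2 (Uᵀ *ᵥ t.ofLp)) := by
    rw [EuclideanSpace.inner_eq_star_dotProduct, EuclideanSpace.inner_eq_star_dotProduct]
    simp only [star_trivial]
    rw [Matrix.dotProduct_mulVec, ← Matrix.mulVec_transpose]
  simp only [Function.comp_apply, e1]
  rw [h]
  dsimp only
  rw [Matrix.dotProduct_mulVec, Matrix.vecMul_mulVec, Matrix.transpose_transpose, hU,
    Matrix.vecMul_one]

/-- The law of a family of `κ` i.i.d. vectors with i.i.d. centred normal entries. -/
noncomputable abbrev gaussianRows (κ ι : Type*) [Fintype κ] [Fintype ι] (v : ℝ≥0) :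
    Measure (κ → ι → ℝ) :=
  Measure.pi fun _ => gaussianVector ι v

theorem map_curry_gaussianVector (κ ι : Type*) [Fintype κ] [Fintype ι] (v : ℝ≥0) :
    (gaussianVector (κ × ι) v).map Function.curry = gaussianRows κ ι v := by
  have h := Measure.infinitePi_map_curry (fun (_ : κ) (_ : ι) => gaussianReal 0 v)
  simp only [Measure.infinitePi_eq_pi] at h
  exact h

/-! ### Gram matrices and LQ decomposition -/

/-- The Gram matrix `X Xᵀ` of the family of vectors `X i`. -/
def gram {κ ι : Type*} [Fintype ι] (X : κ → ι → ℝ) : Matrix κ κ ℝ :=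
  Matrix.of X * (Matrix.of X)ᵀ

theorem gram_apply {κ ι : Type*} [Fintype ι] (X : κ → ι → ℝ) (i j : κ) :
    gram X i j = X i ⬝ᵥ X j := rfl

/-- The matrix whose rows are the vectors of an orthonormal basis of a subspace. -/
noncomputable def basisRows {κ ι : Type*} [Fintype κ] [Fintype ι]
    {K : Submodule ℝ (EuclideanSpace ℝ ι)} (b : OrthonormalBasis κ ℝ K) : Matrix κ ι ℝ :=
  Matrix.of fun j a => (b j : EuclideanSpace ℝ ι) a

section

variable {κ ι : Type*} [Fintype κ] [Fintype ι] {K : Submodule ℝ (EuclideanSpace ℝ ι)}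

theorem basisRows_mulVec (b : OrthonormalBasis κ ℝ K) (x : EuclideanSpace ℝ ι) (j : κ) :
    (basisRows b *ᵥ x.ofLp) j = inner ℝ (b j : EuclideanSpace ℝ ι) x := by
  rw [EuclideanSpace.inner_eq_star_dotProduct, dotProduct_comm]
  rfl

theorem basisRows_mul_transpose [DecidableEq κ] (b : OrthonormalBasis κ ℝ K) :
    basisRows b * (basisRows b)ᵀ = 1 := by
  ext i j
  have h := basisRows_mulVec b (b j) i
  rw [← Submodule.coe_inner, b.inner_eq_ite] at h
  rw [Matrix.one_apply, ← h]
  rfl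

theorem transpose_basisRows_mulVec (b : OrthonormalBasis κ ℝ K) {x : EuclideanSpace ℝ ι}
    (hx : x ∈ K) : (basisRows b)ᵀ *ᵥ (basisRows b *ᵥ x.ofLp) = x.ofLp := by
  have h := congrArg (fun y : K => (y : EuclideanSpace ℝ ι).ofLp) (b.sum_repr' ⟨x, hx⟩)
  simp only [Submodule.coe_sum, Submodule.coe_smul, Submodule.coe_inner] at h
  refine Eq.trans ?_ h
  ext a
  simp only [Matrix.mulVec, dotProduct, WithLp.ofLp_sum, Finset.sum_apply, WithLp.ofLp_smul,
    Pi.smul_apply, smul_eq_mul]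
  refine Finset.sum_congr rfl fun j _ => ?_
  have := basisRows_mulVec b x j
  rw [← this, mul_comm]
  rfl

theorem basisRows_mul_transpose_of_le_orthogonal {κ' : Type*} [Fintype κ']
    {L : Submodule ℝ (EuclideanSpace ℝ ι)} (b : OrthonormalBasis κ ℝ K)
    (b' : OrthonormalBasis κ' ℝ L) (h : L ≤ Kᗮ) :
    basisRows b' * (basisRows b)ᵀ = 0 := by
  ext i j
  have := basisRows_mulVec b' (b j) i
  rw [real_inner_comm, h (b' i).2 _ (b j).2] at this
  exact this

end

theorem linearIndependent_of_det_gram_ne_zero {e m : ℕ} {X : Fin e → Fin m → ℝ}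
    (hX : (gram X).det ≠ 0) : LinearIndependent ℝ X := by
  have : LinearIndependent ℝ (Matrix.of X).row := by
    rw [← Matrix.vecMul_injective_iff]
    rw [← isUnit_iff_ne_zero, ← Matrix.isUnit_iff_isUnit_det] at hX
    intro a b hab
    have := congrArg (fun y => y ᵥ* (Matrix.of X)ᵀ) hab
    simp only [Matrix.vecMul_vecMul] at this
    exact Matrix.vecMul_injective_of_isUnit hX this
  exact this

/-- An LQ decomposition `X = T U₁` of a family of linearly independent vectors, together with an
orthonormal basis `U₂` of the orthogonal complement of its span. -/
theorem exists_lq_decomposition {e m : ℕ} {X : Fin e → Fin m → ℝ} (hX : (gram X).det ≠ 0) :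
    ∃ (k : ℕ) (U₁ : Matrix (Fin e) (Fin m) ℝ) (U₂ : Matrix (Fin k) (Fin m) ℝ)
      (T : Matrix (Fin e) (Fin e) ℝ), e + k = m ∧
      Matrix.fromRows U₁ U₂ * (Matrix.fromRows U₁ U₂)ᵀ = 1 ∧
      U₁ᵀ * U₁ + U₂ᵀ * U₂ = 1 ∧ Matrix.of X = T * U₁ ∧ IsUnit T.det := by
  have hli := linearIndependent_of_det_gram_ne_zero hX
  let r : Fin e → EuclideanSpace ℝ (Fin m) := fun i => WithLp.toLp 2 (X i)
  have hr : LinearIndependent ℝ r :=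
    hli.map' (WithLp.linearEquiv 2 ℝ (Fin m → ℝ)).symm.toLinearMap (LinearEquiv.ker _)
  let K := Submodule.span ℝ (Set.range r)
  have hK : Module.finrank ℝ K = e := by simpa using finrank_span_eq_card hr
  have hdim : e + Module.finrank ℝ Kᗮ = m := by
    rw [← hK, Submodule.finrank_add_finrank_orthogonal, finrank_euclideanSpace_fin]
  let b : OrthonormalBasis (Fin e) ℝ K := (stdOrthonormalBasis ℝ K).reindex (finCongr hK)
  let b' := stdOrthonormalBasis ℝ Kᗮ
  have h21 := basisRows_mul_transpose_of_le_orthogonal b b' le_rfl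
  have h12 : basisRows b * (basisRows b')ᵀ = 0 := by
    rw [← Matrix.transpose_inj, Matrix.transpose_mul, Matrix.transpose_transpose, h21,
      Matrix.transpose_zero]
  have hU : Matrix.fromRows (basisRows b) (basisRows b')
      * (Matrix.fromRows (basisRows b) (basisRows b'))ᵀ = 1 := by
    rw [Matrix.transpose_fromRows, Matrix.fromRows_mul_fromCols, h21, h12,
      basisRows_mul_transpose, basisRows_mul_transpose, Matrix.fromBlocks_one]
  have hTU : Matrix.of X = (Matrix.of X * (basisRows b)ᵀ) * basisRows b := by
    rw [← Matrix.transpose_inj]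
    ext a i
    have h := transpose_basisRows_mulVec b
      (Submodule.subset_span (Set.mem_range_self i) : r i ∈ K)
    have h' := congrFun h a
    rw [Matrix.mulVec_mulVec] at h'
    rw [Matrix.transpose_mul, Matrix.transpose_mul, Matrix.transpose_transpose, ← Matrix.mul_assoc]
    exact h'.symm
  refine ⟨_, basisRows b, basisRows b', Matrix.of X * (basisRows b)ᵀ, hdim, hU, ?_, hTU, ?_⟩
  · have := (Matrix.mul_eq_one_comm_of_card_eq _ _ _ (by simpa using hdim)).1 hU
    rwa [Matrix.transpose_fromRows, Matrix.fromCols_mul_fromRows] at this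
  · have : gram X = (Matrix.of X * (basisRows b)ᵀ) * (Matrix.of X * (basisRows b)ᵀ)ᵀ := by
      rw [Matrix.transpose_mul, Matrix.transpose_transpose, ← Matrix.mul_assoc, ← hTU]
      rfl
    rw [this, Matrix.det_mul] at hX
    exact (left_ne_zero_of_mul hX).isUnit

/-! ### A column of the inverse Gram matrix -/

section

variable {e m k : ℕ} (p : Fin (e + 1)) {X : Fin e → Fin m → ℝ} {U₁ : Matrix (Fin e) (Fin m) ℝ}
  {U₂ : Matrix (Fin k) (Fin m) ℝ} {T : Matrix (Fin e) (Fin e) ℝ} {x : Fin m → ℝ}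

theorem gram_eq_of_lq (h11 : U₁ * U₁ᵀ = 1) (hX : Matrix.of X = T * U₁) : gram X = T * Tᵀ := by
  rw [gram, hX, Matrix.transpose_mul, Matrix.mul_assoc, ← Matrix.mul_assoc U₁, h11,
    Matrix.one_mul]

theorem det_gram_insertNth_ne_zero (h11 : U₁ * U₁ᵀ = 1) (h21 : U₂ * U₁ᵀ = 0)
    (hX : Matrix.of X = T * U₁) (hT : IsUnit T.det) (hx : U₂ *ᵥ x ≠ 0) :
    (gram (p.insertNth x X)).det ≠ 0 := by
  intro h0
  obtain ⟨z, hz, hz0⟩ := Matrix.exists_mulVec_eq_zero_iff.2 h0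
  rw [gram, ← Matrix.conjTranspose_eq_transpose_of_trivial,
    Matrix.self_mul_conjTranspose_mulVec_eq_zero,
    Matrix.conjTranspose_eq_transpose_of_trivial] at hz0
  have h1 : (Matrix.of (p.insertNth x X : Fin (e + 1) → Fin m → ℝ))ᵀ *ᵥ z
      = z p • x + U₁ᵀ *ᵥ (Tᵀ *ᵥ fun j => z (p.succAbove j)) := by
    rw [Matrix.mulVec_mulVec, ← Matrix.transpose_mul, ← hX]
    ext a
    simp [Matrix.mulVec, dotProduct, Fin.sum_univ_succAbove _ p, mul_comm]
  rw [h1] at hz0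
  have h2 := congrArg (fun y => U₂ *ᵥ y) hz0
  simp only [Matrix.mulVec_add, Matrix.mulVec_smul, Matrix.mulVec_mulVec, Matrix.mulVec_zero] at h2
  rw [← Matrix.mul_assoc, h21, Matrix.zero_mul, Matrix.zero_mulVec, add_zero] at h2
  have hzp : z p = 0 := (smul_eq_zero.1 h2).resolve_right hx
  have h3 := congrArg (fun y => U₁ *ᵥ y) hz0
  simp only [hzp, zero_smul, zero_add, Matrix.mulVec_mulVec, Matrix.mulVec_zero] at h3
  rw [← Matrix.mul_assoc, h11, Matrix.one_mul] at h3
  have h4 : (fun j => z (p.succAbove j)) = 0 :=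
    Matrix.eq_zero_of_mulVec_eq_zero (by rw [Matrix.det_transpose]; exact hT.ne_zero) h3
  apply hz
  ext i
  refine p.succAboveCases ?_ (fun j => ?_) i
  · exact hzp
  · exact congrFun h4 j

/-- A column of the inverse Gram matrix, by block inversion: if `X = T U₁` is an LQ decomposition
and `U₂` completes `U₁` to an orthogonal matrix, the column at the position of an added vector `x`
depends on `x` through the independent coordinates `U₁ x` and `U₂ x` only. -/
theorem inv_gram_insertNth (h11 : U₁ * U₁ᵀ = 1) (h21 : U₂ * U₁ᵀ = 0)
    (hsum : U₁ᵀ * U₁ + U₂ᵀ * U₂ = 1) (hX : Matrix.of X = T * U₁) (hT : IsUnit T.det)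
    (hx : 0 < (U₂ *ᵥ x) ⬝ᵥ (U₂ *ᵥ x)) :
    (gram (p.insertNth x X))⁻¹ p p = 1 / ((U₂ *ᵥ x) ⬝ᵥ (U₂ *ᵥ x)) ∧
    ∀ j, (gram (p.insertNth x X))⁻¹ (p.succAbove j) p
      = -(T⁻¹ᵀ *ᵥ (U₁ *ᵥ x)) j / ((U₂ *ᵥ x) ⬝ᵥ (U₂ *ᵥ x)) := by
  set β := (U₂ *ᵥ x) ⬝ᵥ (U₂ *ᵥ x) with hβ
  set s := T⁻¹ᵀ *ᵥ (U₁ *ᵥ x) with hs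
  have hTs : Tᵀ *ᵥ s = U₁ *ᵥ x := by
    rw [hs, Matrix.mulVec_mulVec, ← Matrix.transpose_mul, Matrix.nonsing_inv_mul _ hT,
      Matrix.transpose_one, Matrix.one_mulVec]
  have hxx : x ⬝ᵥ x = (U₁ *ᵥ x) ⬝ᵥ (U₁ *ᵥ x) + β := by
    have h (l : ℕ) (U : Matrix (Fin l) (Fin m) ℝ) :
        x ⬝ᵥ ((Uᵀ * U) *ᵥ x) = (U *ᵥ x) ⬝ᵥ (U *ᵥ x) := by
      rw [← Matrix.mulVec_mulVec, Matrix.dotProduct_mulVec, Matrix.vecMul_transpose]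
    rw [hβ, ← h, ← h, ← dotProduct_add, ← Matrix.add_mulVec, hsum, Matrix.one_mulVec]
  have hXs : (Matrix.of X)ᵀ *ᵥ s = U₁ᵀ *ᵥ (U₁ *ᵥ x) := by
    rw [hX, Matrix.transpose_mul, ← Matrix.mulVec_mulVec, hTs]
  -- `c` is the claimed column: it is enough that the Gram matrix maps it to a basis vector.
  let c : Fin (e + 1) → ℝ := p.insertNth (1 / β) (fun j => -s j / β)
  have hYc : (Matrix.of (p.insertNth x X : Fin (e + 1) → Fin m → ℝ))ᵀ *ᵥ c
      = (1 / β) • (x - U₁ᵀ *ᵥ (U₁ *ᵥ x)) := by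
    rw [← hXs]
    ext a
    simp only [Matrix.mulVec, dotProduct, Fin.sum_univ_succAbove _ p, Matrix.transpose_apply,
      Matrix.of_apply, Fin.insertNth_apply_same, Fin.insertNth_apply_succAbove, Pi.smul_apply,
      Pi.sub_apply, smul_eq_mul, c]
    rw [mul_sub, Finset.mul_sum, sub_eq_add_neg, ← Finset.sum_neg_distrib, mul_comm]
    congr 1
    refine Finset.sum_congr rfl fun j _ => ?_
    ring
  have hrow {l : ℕ} (Y : Fin l → Fin m → ℝ) (y : Fin m → ℝ) (i : Fin l) :
      (Matrix.of Y *ᵥ y) i = Y i ⬝ᵥ y := rfl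
  have hc : gram (p.insertNth x X) *ᵥ c = Pi.single p 1 := by
    rw [gram, ← Matrix.mulVec_mulVec, hYc]
    ext i
    refine p.succAboveCases ?_ (fun j => ?_) i
    · rw [Pi.single_eq_same]
      have : (x ⬝ᵥ U₁ᵀ *ᵥ (U₁ *ᵥ x)) = (U₁ *ᵥ x) ⬝ᵥ (U₁ *ᵥ x) := by
        rw [Matrix.dotProduct_mulVec, Matrix.vecMul_transpose]
      simp only [Matrix.mulVec_smul, Pi.smul_apply, smul_eq_mul]
      rw [hrow, Fin.insertNth_apply_same, dotProduct_sub, this, hxx]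
      field_simp
      ring
    · rw [Pi.single_eq_of_ne (Fin.succAbove_ne p j)]
      have h1 : Matrix.of X *ᵥ (x - U₁ᵀ *ᵥ (U₁ *ᵥ x)) = 0 := by
        rw [hX, ← Matrix.mulVec_mulVec, Matrix.mulVec_sub, Matrix.mulVec_mulVec _ U₁, h11,
          Matrix.one_mulVec, sub_self, Matrix.mulVec_zero]
      have h2 := congrFun h1 j
      simp only [Matrix.mulVec_smul, Pi.smul_apply, smul_eq_mul]
      rw [hrow, Fin.insertNth_apply_succAbove]
      rw [hrow] at h2
      rw [h2, Pi.zero_apply, mul_zero]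
  have hdet : IsUnit (gram (p.insertNth x X)).det :=
    (det_gram_insertNth_ne_zero p h11 h21 hX hT fun h => by simp [hβ, h] at hx).isUnit
  have hcol : (gram (p.insertNth x X))⁻¹ *ᵥ Pi.single p 1 = c := by
    rw [← hc, Matrix.mulVec_mulVec, Matrix.nonsing_inv_mul _ hdet, Matrix.one_mulVec]
  rw [Matrix.mulVec_single_one] at hcol
  refine ⟨?_, fun j => ?_⟩
  · simpa [c] using congrFun hcol p
  · simpa [c] using congrFun hcol (p.succAbove j)

end

/-! ### Gaussian rows -/

theorem continuous_gram {d m : ℕ} : Continuous fun X : Fin d → Fin m → ℝ => gram X :=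
  Continuous.matrix_mul continuous_id continuous_id.matrix_transpose

theorem measurable_inv_gram {d m : ℕ} (i j : Fin d) :
    Measurable fun X : Fin d → Fin m → ℝ => (gram X)⁻¹ i j := by
  simp_rw [Matrix.inv_def, Ring.inverse_eq_inv', Matrix.smul_apply, smul_eq_mul]
  exact continuous_gram.matrix_det.measurable.inv.mul
    ((continuous_gram.matrix_adjugate.matrix_elem i j).measurable)

theorem measurable_det_gram {d m : ℕ} :
    Measurable fun X : Fin d → Fin m → ℝ => (gram X).det :=
  continuous_gram.matrix_det.measurable

/-- Separation of the row `p` from the other rows. -/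
theorem measurePreserving_insertNth_gaussianRows (e m : ℕ) (v : ℝ≥0) (p : Fin (e + 1)) :
    MeasurePreserving (fun z : (Fin m → ℝ) × (Fin e → Fin m → ℝ) =>
        (p.insertNth z.1 z.2 : Fin (e + 1) → Fin m → ℝ))
      ((gaussianVector (Fin m) v).prod (gaussianRows (Fin e) (Fin m) v))
      (gaussianRows (Fin (e + 1)) (Fin m) v) :=
  (measurePreserving_piFinSuccAbove (fun _ : Fin (e + 1) => gaussianVector (Fin m) v) p).symm

theorem lintegral_gaussianRows_succ {e m : ℕ} (v : ℝ≥0) (p : Fin (e + 1))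
    {F : (Fin (e + 1) → Fin m → ℝ) → ENNReal} (hF : Measurable F) :
    ∫⁻ Y, F Y ∂gaussianRows (Fin (e + 1)) (Fin m) v
      = ∫⁻ X, ∫⁻ x, F (p.insertNth x X) ∂gaussianVector (Fin m) v
        ∂gaussianRows (Fin e) (Fin m) v := by
  have h := measurePreserving_insertNth_gaussianRows e m v p
  rw [← h.lintegral_comp hF]
  exact lintegral_prod_symm' _ (hF.comp h.measurable)

/-- The coordinates of a Gaussian vector along orthogonal complementary subspaces are independent
Gaussian vectors. -/
theorem measurePreserving_mulVec_prod_gaussianVector {e k m : ℕ} (v : ℝ≥0)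
    {U₁ : Matrix (Fin e) (Fin m) ℝ} {U₂ : Matrix (Fin k) (Fin m) ℝ}
    (hU : Matrix.fromRows U₁ U₂ * (Matrix.fromRows U₁ U₂)ᵀ = 1) :
    MeasurePreserving (fun x => (U₁ *ᵥ x, U₂ *ᵥ x)) (gaussianVector (Fin m) v)
      ((gaussianVector (Fin e) v).prod (gaussianVector (Fin k) v)) := by
  have h1 : MeasurePreserving (fun x => Matrix.fromRows U₁ U₂ *ᵥ x) (gaussianVector (Fin m) v)
      (gaussianVector (Fin e ⊕ Fin k) v) :=
    ⟨by unfold Matrix.mulVec dotProduct; fun_prop, map_mulVec_gaussianVector v _ hU⟩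
  exact (measurePreserving_sumPiEquivProdPi (fun _ : Fin e ⊕ Fin k => gaussianReal 0 v)).comp h1

theorem lintegral_dotProduct_sq_gaussianVector {e : ℕ} (v : ℝ≥0) (w : Fin e → ℝ) :
    ∫⁻ x, ENNReal.ofReal ((w ⬝ᵥ x) ^ 2) ∂gaussianVector (Fin e) v
      = ENNReal.ofReal (v * (w ⬝ᵥ w)) := by
  have hL (i : Fin e) : MemLp (fun x : Fin e → ℝ => w i * x i) 2 (gaussianVector (Fin e) v) :=
    ((IsGaussian.memLp_two_id (μ := gaussianReal 0 v)).comp_measurePreserving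
      (measurePreserving_eval (fun _ => gaussianReal 0 v) i)).const_mul _
  have hS : MemLp (fun x : Fin e → ℝ => w ⬝ᵥ x) 2 (gaussianVector (Fin e) v) :=
    memLp_finsetSum _ fun i _ => hL i
  have h0 : ∫ x, w ⬝ᵥ x ∂gaussianVector (Fin e) v = 0 := by
    unfold dotProduct
    rw [integral_finsetSum _ fun i _ => (hL i).integrable one_le_two]
    refine Finset.sum_eq_zero fun i _ => ?_
    rw [integral_const_mul, integral_comp_eval (μ := fun _ : Fin e => gaussianReal 0 v)
      (f := fun y : ℝ => y) (by fun_prop)]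
    simp
  have hV : Var[fun x : Fin e → ℝ => w ⬝ᵥ x; gaussianVector (Fin e) v] = v * (w ⬝ᵥ w) := by
    have h := variance_sum_pi (μ := fun _ : Fin e => gaussianReal 0 v)
      (X := fun i y => w i * y)
      (fun i => (IsGaussian.memLp_two_id (μ := gaussianReal 0 v)).const_mul _)
    have e1 : (fun x : Fin e → ℝ => w ⬝ᵥ x) = ∑ i, fun x : Fin e → ℝ => w i * x i := by
      ext x; simp [dotProduct]
    rw [e1, h]
    change ∑ i, Var[fun y => w i * id y; gaussianReal 0 v] = _
    simp_rw [variance_const_mul, variance_id_gaussianReal, dotProduct, Finset.mul_sum]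
    exact Finset.sum_congr rfl fun i _ => by ring
  rw [variance_of_integral_eq_zero hS.1.aemeasurable h0] at hV
  rw [← hV, ofReal_integral_eq_lintegral_ofReal hS.integrable_sq (ae_of_all _ fun x => sq_nonneg _)]

/-- At most `m` Gaussian vectors in dimension `m` are almost surely linearly independent: given the
others, the component of the first one orthogonal to their span is almost surely nonzero. -/
theorem gaussianRows_ae_det_gram_ne_zero {v : ℝ≥0} (hv : v ≠ 0) {m : ℕ} :
    ∀ {e : ℕ}, e ≤ m → ∀ᵐ X ∂gaussianRows (Fin e) (Fin m) v, (gram X).det ≠ 0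
  | 0, _ => by simp
  | e + 1, he => by
    have hmp := (measurePreserving_piFinSuccAbove
      (fun _ : Fin (e + 1) => gaussianVector (Fin m) v) 0)
    have hms : MeasurableSet {z : (Fin m → ℝ) × (Fin e → Fin m → ℝ) |
        (gram ((0 : Fin (e + 1)).insertNth z.1 z.2 : Fin (e + 1) → Fin m → ℝ)).det ≠ 0} :=
      (measurable_det_gram.comp
        (measurePreserving_insertNth_gaussianRows e m v 0).measurable)
        (measurableSet_singleton 0).compl
    have h : ∀ᵐ z ∂(gaussianVector (Fin m) v).prod (gaussianRows (Fin e) (Fin m) v),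
        (gram ((0 : Fin (e + 1)).insertNth z.1 z.2 : Fin (e + 1) → Fin m → ℝ)).det ≠ 0 := by
      rw [← Measure.prod_swap, ae_map_iff (by fun_prop) hms]
      refine (Measure.ae_prod_iff_ae_ae (measurable_swap hms)).2 ?_
      filter_upwards [gaussianRows_ae_det_gram_ne_zero hv (by omega : e ≤ m)] with X hX
      obtain ⟨k, U₁, U₂, T, hk, hU, hsum, hXT, hT⟩ := exists_lq_decomposition hX
      have hU' := hU
      rw [Matrix.transpose_fromRows, Matrix.fromRows_mul_fromCols, ← Matrix.fromBlocks_one,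
        Matrix.fromBlocks_inj] at hU'
      have h2 := (measurePreserving_snd.comp
        (measurePreserving_mulVec_prod_gaussianVector v hU)).quasiMeasurePreserving.ae
        (gaussianVector_ae_dotProduct_self_pos hv (by omega : 0 < k))
      filter_upwards [h2] with x hx
      refine det_gram_insertNth_ne_zero 0 hU'.1 hU'.2.2.1 hXT hT fun h0 => ?_
      change U₂ *ᵥ x = 0 at h0
      simp [h0] at hx
    filter_upwards [hmp.quasiMeasurePreserving.ae h] with Y hY
    have := (MeasurableEquiv.piFinSuccAbove (fun _ : Fin (e + 1) => Fin m → ℝ) 0).symm_apply_apply Y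
    rw [← this]
    exact hY

/-! ### First and second moments of the inverse Gram matrix -/

/-- Conditionally on all rows `X` but one, a column of the inverse Gram matrix is a ratio of
functions of two independent Gaussian vectors `a` and `b`: its entries are `1 / |b|²` and
`-(T⁻ᵀ a) j / |b|²`, where `(T Tᵀ)⁻¹` is the inverse Gram matrix of `X`. -/
theorem gaussianRows_ae_inv_gram_insertNth {v : ℝ≥0} (hv : v ≠ 0) {e m : ℕ} (he : e < m)
    (p : Fin (e + 1)) :
    ∀ᵐ X ∂gaussianRows (Fin e) (Fin m) v,
      ∃ (f : (Fin m → ℝ) → (Fin e → ℝ) × (Fin (m - e) → ℝ)) (T : Matrix (Fin e) (Fin e) ℝ),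
        MeasurePreserving f (gaussianVector (Fin m) v)
          ((gaussianVector (Fin e) v).prod (gaussianVector (Fin (m - e)) v)) ∧
        (gram X)⁻¹ = T⁻¹ᵀ * T⁻¹ ∧
        ∀ᵐ x ∂gaussianVector (Fin m) v,
          (gram (p.insertNth x X))⁻¹ p p = 1 / ((f x).2 ⬝ᵥ (f x).2) ∧
          ∀ j, (gram (p.insertNth x X))⁻¹ (p.succAbove j) p
            = -(T⁻¹ᵀ *ᵥ (f x).1) j / ((f x).2 ⬝ᵥ (f x).2) := by
  filter_upwards [gaussianRows_ae_det_gram_ne_zero hv he.le] with X hX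
  obtain ⟨k, U₁, U₂, T, hk, hU, hsum, hXT, hT⟩ := exists_lq_decomposition hX
  obtain rfl : k = m - e := by omega
  have hU' := hU
  rw [Matrix.transpose_fromRows, Matrix.fromRows_mul_fromCols, ← Matrix.fromBlocks_one,
    Matrix.fromBlocks_inj] at hU'
  have hf := measurePreserving_mulVec_prod_gaussianVector v hU
  refine ⟨_, T, hf, ?_, ?_⟩
  · rw [gram_eq_of_lq hU'.1 hXT, Matrix.mul_inv_rev, Matrix.transpose_nonsing_inv]
  · have h2 := (measurePreserving_snd.comp hf).quasiMeasurePreserving.ae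
      (gaussianVector_ae_dotProduct_self_pos hv (by omega : 0 < m - e))
    filter_upwards [h2] with x hx
    exact inv_gram_insertNth p hU'.1 hU'.2.2.1 hsum hXT hT hx

theorem lintegral_inv_gram_diag {v : ℝ≥0} (hv : v ≠ 0) {d m : ℕ} (hd : d + 1 < m) (p : Fin d) :
    ∫⁻ Y, ENNReal.ofReal ((gram Y)⁻¹ p p) ∂gaussianRows (Fin d) (Fin m) v
      = ENNReal.ofReal (1 / (v * (m - d - 1))) := by
  obtain _ | e := d
  · exact p.elim0
  rw [lintegral_gaussianRows_succ v p (measurable_inv_gram p p).ennreal_ofReal]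
  have h : ∀ᵐ X ∂gaussianRows (Fin e) (Fin m) v,
      ∫⁻ x, ENNReal.ofReal ((gram (p.insertNth x X))⁻¹ p p) ∂gaussianVector (Fin m) v
        = ENNReal.ofReal (1 / (v * (m - (e + 1 : ℕ) - 1))) := by
    filter_upwards [gaussianRows_ae_inv_gram_insertNth hv (by omega : e < m) p]
      with X ⟨f, T, hf, _, hx⟩
    have hb : Measurable fun b : Fin (m - e) → ℝ => ENNReal.ofReal (1 / (b ⬝ᵥ b)) := by
      unfold dotProduct; fun_prop
    calc _ = ∫⁻ x, ENNReal.ofReal (1 / ((f x).2 ⬝ᵥ (f x).2)) ∂gaussianVector (Fin m) v :=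
          lintegral_congr_ae (hx.mono fun x h => by simp only [h.1])
      _ = ∫⁻ b, ENNReal.ofReal (1 / (b ⬝ᵥ b)) ∂gaussianVector (Fin (m - e)) v :=
          (measurePreserving_snd.comp hf).lintegral_comp hb
      _ = _ := by
          rw [lintegral_inv_dotProduct_gaussianVector hv (by omega), Nat.cast_sub (by omega)]
          push_cast
          ring_nf
  rw [lintegral_congr_ae h, lintegral_const, measure_univ, mul_one]

/-- The second moment of a column of the inverse Gram matrix. The factor `1 + v E[tr (X Xᵀ)⁻¹]`,
with `X` the other rows, comes from the components of the column along and off the diagonal. -/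
theorem lintegral_sum_inv_gram_sq {v : ℝ≥0} (hv : v ≠ 0) {e m : ℕ} (he : e + 4 < m)
    (p : Fin (e + 1)) :
    ∫⁻ Y, ENNReal.ofReal (∑ i, (gram Y)⁻¹ i p ^ 2) ∂gaussianRows (Fin (e + 1)) (Fin m) v
      = ENNReal.ofReal ((m - 1) / (v ^ 2 * ((m - e - 1) * (m - e - 2) * (m - e - 4)))) := by
  have hv0 : (0 : ℝ) < v := by positivity
  have hem : (e : ℝ) + 4 < m := by exact_mod_cast he
  have hmeas : Measurable fun Y : Fin (e + 1) → Fin m → ℝ =>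
      ENNReal.ofReal (∑ i, (gram Y)⁻¹ i p ^ 2) :=
    (Finset.measurable_fun_sum _ fun i _ => (measurable_inv_gram i p).pow_const 2).ennreal_ofReal
  rw [lintegral_gaussianRows_succ v p hmeas]
  have h : ∀ᵐ X ∂gaussianRows (Fin e) (Fin m) v,
      ∫⁻ x, ENNReal.ofReal (∑ i, (gram (p.insertNth x X))⁻¹ i p ^ 2) ∂gaussianVector (Fin m) v
        = (1 + ∑ j, ENNReal.ofReal v * ENNReal.ofReal ((gram X)⁻¹ j j))
          * ENNReal.ofReal (1 / (v ^ 2 * ((m - e - 2) * (m - e - 4)))) := by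
    filter_upwards [gaussianRows_ae_inv_gram_insertNth hv (by omega : e < m) p]
      with X ⟨f, T, hf, hT, hx⟩
    have hb : Measurable fun b : Fin (m - e) → ℝ => ENNReal.ofReal (1 / (b ⬝ᵥ b) ^ 2) := by
      unfold dotProduct; fun_prop
    have ha (j : Fin e) :
        Measurable fun a : Fin e → ℝ => ENNReal.ofReal ((T⁻¹ᵀ j ⬝ᵥ a) ^ 2) := by
      unfold dotProduct; fun_prop
    have ha' : Measurable fun a : Fin e → ℝ => 1 + ∑ j, ENNReal.ofReal ((T⁻¹ᵀ j ⬝ᵥ a) ^ 2) :=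
      measurable_const.add (Finset.measurable_fun_sum _ fun j _ => ha j)
    calc _ = ∫⁻ x, (1 + ∑ j, ENNReal.ofReal ((T⁻¹ᵀ j ⬝ᵥ (f x).1) ^ 2))
            * ENNReal.ofReal (1 / ((f x).2 ⬝ᵥ (f x).2) ^ 2) ∂gaussianVector (Fin m) v := by
          refine lintegral_congr_ae (hx.mono fun x h => ?_)
          dsimp only
          rw [Fin.sum_univ_succAbove _ p, h.1, ← ENNReal.ofReal_sum_of_nonneg
            (fun _ _ => sq_nonneg _), ← ENNReal.ofReal_one, ← ENNReal.ofReal_add zero_le_one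
            (Finset.sum_nonneg fun _ _ => sq_nonneg _), ← ENNReal.ofReal_mul
            (add_nonneg zero_le_one (Finset.sum_nonneg fun _ _ => sq_nonneg _)), add_mul,
            Finset.sum_mul]
          congr 2
          · rw [one_mul, div_pow, one_pow]
          · refine Finset.sum_congr rfl fun j _ => ?_
            rw [h.2 j, div_pow, neg_sq, mul_one_div]
            rfl
      _ = ∫⁻ z, (1 + ∑ j, ENNReal.ofReal ((T⁻¹ᵀ j ⬝ᵥ z.1) ^ 2))
            * ENNReal.ofReal (1 / (z.2 ⬝ᵥ z.2) ^ 2)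
            ∂(gaussianVector (Fin e) v).prod (gaussianVector (Fin (m - e)) v) :=
          hf.lintegral_comp ((ha'.comp measurable_fst).mul (hb.comp measurable_snd))
      _ = _ := by
          rw [lintegral_prod_mul ha'.aemeasurable hb.aemeasurable,
            lintegral_inv_sq_dotProduct_gaussianVector hv (by omega), Nat.cast_sub (by omega),
            lintegral_add_left measurable_const, lintegral_finsetSum _ fun j _ => ha j]
          simp_rw [lintegral_dotProduct_sq_gaussianVector]
          rw [lintegral_const, measure_univ, mul_one, hT]
          congr 2
          refine Finset.sum_congr rfl fun j _ => ?_
          rw [← ENNReal.ofReal_mul hv0.le]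
          rfl
  have hd (j : Fin e) :
      Measurable fun X : Fin e → Fin m → ℝ => ENNReal.ofReal v * ENNReal.ofReal ((gram X)⁻¹ j j) :=
    (measurable_inv_gram j j).ennreal_ofReal.const_mul _
  rw [lintegral_congr_ae h, lintegral_mul_const' _ _ ENNReal.ofReal_ne_top,
    lintegral_add_left measurable_const, lintegral_finsetSum _ fun j _ => hd j]
  simp_rw [lintegral_const_mul' _ _ ENNReal.ofReal_ne_top,
    lintegral_inv_gram_diag hv (by omega : e + 1 < m)]
  rw [lintegral_const, measure_univ, mul_one, Finset.sum_const, Finset.card_univ,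
    Fintype.card_fin, nsmul_eq_mul, ← ENNReal.ofReal_natCast, ← ENNReal.ofReal_one]
  have h1 : 0 < (m : ℝ) - e - 1 := by linarith
  have h2 : 0 < (m : ℝ) - e - 2 := by linarith
  have h4 : 0 < (m : ℝ) - e - 4 := by linarith
  rw [← ENNReal.ofReal_mul hv0.le, ← ENNReal.ofReal_mul (by positivity),
    ← ENNReal.ofReal_add zero_le_one (by positivity), ← ENNReal.ofReal_mul (by positivity)]
  congr 1
  field_simp
  ring

theorem posSemidef_inv_gram {d m : ℕ} (Y : Fin d → Fin m → ℝ) : (gram Y)⁻¹.PosSemidef :=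
  (Matrix.posSemidef_self_mul_conjTranspose (Matrix.of Y)).inv

theorem abs_apply_le_add_diag_of_posSemidef {d : ℕ} {M : Matrix (Fin d) (Fin d) ℝ}
    (hM : M.PosSemidef) (i j : Fin d) : |M i j| ≤ M i i + M j j := by
  have hs : M j i = M i j := by simpa using hM.isHermitian.apply i j
  have h1 := hM.dotProduct_mulVec_nonneg (Pi.single i 1 + Pi.single j 1)
  have h2 := hM.dotProduct_mulVec_nonneg (Pi.single i 1 - Pi.single j 1)
  simp only [star_trivial, Matrix.mulVec_add, Matrix.mulVec_sub, dotProduct_add, dotProduct_sub,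
    add_dotProduct, sub_dotProduct, Matrix.mulVec_single_one, single_dotProduct, one_mul,
    Matrix.col_apply, hs] at h1 h2
  have h3 := hM.diag_nonneg (i := i)
  have h4 := hM.diag_nonneg (i := j)
  rw [abs_le]
  constructor <;> linarith

theorem integrable_inv_gram_diag {v : ℝ≥0} (hv : v ≠ 0) {d m : ℕ} (hd : d + 1 < m) (p : Fin d) :
    Integrable (fun Y => (gram Y)⁻¹ p p) (gaussianRows (Fin d) (Fin m) v) := by
  refine ⟨(measurable_inv_gram p p).aestronglyMeasurable, ?_⟩
  rw [hasFiniteIntegral_iff_ofReal (ae_of_all _ fun Y =>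
    (posSemidef_inv_gram Y).diag_nonneg), lintegral_inv_gram_diag hv hd p]
  exact ENNReal.ofReal_lt_top

theorem integral_inv_gram_diag {v : ℝ≥0} (hv : v ≠ 0) {d m : ℕ} (hd : d + 1 < m) (p : Fin d) :
    ∫ Y, (gram Y)⁻¹ p p ∂gaussianRows (Fin d) (Fin m) v = 1 / (v * (m - d - 1)) := by
  have hd' : (d : ℝ) + 1 < m := by exact_mod_cast hd
  rw [integral_eq_lintegral_of_nonneg_ae (ae_of_all _ fun Y => (posSemidef_inv_gram Y).diag_nonneg)
    (measurable_inv_gram p p).aestronglyMeasurable, lintegral_inv_gram_diag hv hd p,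
    ENNReal.toReal_ofReal]
  have : 0 < (m : ℝ) - d - 1 := by linarith
  positivity

/-- The entries are dominated by the diagonal ones, since the inverse Gram matrix is positive
semidefinite. -/
theorem integrable_inv_gram {v : ℝ≥0} (hv : v ≠ 0) {d m : ℕ} (hd : d + 1 < m) (i j : Fin d) :
    Integrable (fun Y => (gram Y)⁻¹ i j) (gaussianRows (Fin d) (Fin m) v) := by
  refine ((integrable_inv_gram_diag hv hd i).add (integrable_inv_gram_diag hv hd j)).mono'
    (measurable_inv_gram i j).aestronglyMeasurable (ae_of_all _ fun Y =>
    abs_apply_le_add_diag_of_posSemidef (posSemidef_inv_gram Y) i j)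

/-- The sign change of one row preserves the Gaussian law and changes the sign of the off-diagonal
entries of the inverse Gram matrix in that row. -/
theorem integral_inv_gram_off_diag (v : ℝ≥0) {d m : ℕ} {i j : Fin d} (hij : i ≠ j) :
    ∫ Y, (gram Y)⁻¹ i j ∂gaussianRows (Fin d) (Fin m) v = 0 := by
  let s : Fin d → ℝ := fun l => if l = i then -1 else 1
  have hs (l : Fin d) : s l * s l = 1 := by simp only [s]; split <;> norm_num
  have hrow (l : Fin d) : MeasurePreserving (fun x : Fin m → ℝ => s l • x)
      (gaussianVector (Fin m) v) (gaussianVector (Fin m) v) := by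
    refine measurePreserving_pi (f := fun _ (y : ℝ) => s l * y) _ _ fun a => ⟨by fun_prop, ?_⟩
    rw [gaussianReal_map_const_mul, mul_zero]
    congr 1
    ext
    simp [pow_two, hs]
  have hflip : MeasurePreserving (fun (Y : Fin d → Fin m → ℝ) l => s l • Y l)
      (gaussianRows (Fin d) (Fin m) v) (gaussianRows (Fin d) (Fin m) v) :=
    measurePreserving_pi _ _ hrow
  have hD : (Matrix.diagonal s)⁻¹ = Matrix.diagonal s :=
    Matrix.inv_eq_right_inv (by simp [Matrix.diagonal_mul_diagonal, hs])
  have hinv (Y : Fin d → Fin m → ℝ) : (gram fun l => s l • Y l)⁻¹ i j = -(gram Y)⁻¹ i j := by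
    have : (gram fun l => s l • Y l) = Matrix.diagonal s * gram Y * Matrix.diagonal s := by
      ext a b
      rw [Matrix.mul_diagonal, Matrix.diagonal_mul, gram_apply, gram_apply, smul_dotProduct,
        dotProduct_smul, smul_eq_mul, smul_eq_mul]
      ring
    rw [this, Matrix.mul_inv_rev, Matrix.mul_inv_rev, hD, ← Matrix.mul_assoc,
      Matrix.mul_diagonal, Matrix.diagonal_mul]
    simp [s, hij.symm]
  have h := integral_map (μ := gaussianRows (Fin d) (Fin m) v) hflip.aemeasurable
    (measurable_inv_gram i j).aestronglyMeasurable
  rw [hflip.map_eq] at h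
  simp_rw [hinv, integral_neg] at h
  linarith

/-! ### Reduction of the sketch to orthonormal coordinates -/

/-- A Gaussian sketch maps orthonormal vectors to i.i.d. Gaussian vectors. -/
theorem IsGaussianSketch.hasLaw_mulVec {Ω : Type*} [MeasurableSpace Ω] {P : Measure Ω}
    [IsProbabilityMeasure P] {m n d : ℕ} {S : Ω → Matrix (Fin m) (Fin n) ℝ}
    (hS : IsGaussianSketch S P) {B : Matrix (Fin d) (Fin n) ℝ} (hB : B * Bᵀ = 1) :
    HasLaw (fun ω j => S ω *ᵥ B j) (gaussianRows (Fin d) (Fin m) (1 / m)) P := by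
  have h1 : HasLaw (fun ω (p : Fin m × Fin n) => S ω p.1 p.2)
      (gaussianVector (Fin m × Fin n) (1 / m)) P := by
    refine ⟨aemeasurable_pi_lambda _ fun p => (hS.hasLaw_entry p.1 p.2).aemeasurable, ?_⟩
    refine ((iIndepFun_iff_map_fun_eq_pi_map fun p : Fin m × Fin n =>
      (hS.hasLaw_entry p.1 p.2).aemeasurable).1 hS.indep_entries).trans ?_
    congr 1
    funext p
    exact (hS.hasLaw_entry p.1 p.2).map_eq
  -- `U` is the Kronecker product of `B` with the identity, acting on the entries of `S`.
  let U : Matrix (Fin d × Fin m) (Fin m × Fin n) ℝ :=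
    Matrix.of fun q p => if q.2 = p.1 then B q.1 p.2 else 0
  have hU : U * Uᵀ = 1 := by
    ext ⟨j, i⟩ ⟨j', i'⟩
    have h : (B * Bᵀ) j j' = ∑ a, B j a * B j' a := rfl
    rw [hB] at h
    simp only [Matrix.mul_apply, U, Matrix.transpose_apply, Matrix.of_apply,
      Fintype.sum_prod_type, ite_mul, zero_mul, mul_ite, mul_zero]
    by_cases hi : i = i'
    · subst hi
      simp [← h, Matrix.one_apply]
    · simp [hi]
  have h2 : HasLaw (fun x : Fin m × Fin n → ℝ => Function.curry (U *ᵥ x))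
      (gaussianRows (Fin d) (Fin m) (1 / m)) (gaussianVector (Fin m × Fin n) (1 / m)) := by
    have hm : Measurable fun x : Fin m × Fin n → ℝ => U *ᵥ x := by
      unfold Matrix.mulVec dotProduct; fun_prop
    refine ⟨(measurable_curry.comp hm).aemeasurable, ?_⟩
    rw [← map_curry_gaussianVector, ← map_mulVec_gaussianVector _ U hU,
      Measure.map_map measurable_curry hm]
    rfl
  convert! h2.comp h1 using 1
  ext ω j i
  simp only [Function.comp_apply, Function.curry_apply, Matrix.mulVec, dotProduct, U,
    Matrix.of_apply, Fintype.sum_prod_type, ite_mul, zero_mul]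
  simp [mul_comm]

/-- Every nonzero vector is a positive multiple of the first vector of an orthonormal basis. -/
theorem exists_orthonormalBasis_zero_eq_smul {E : Type*} [NormedAddCommGroup E]
    [InnerProductSpace ℝ E] {e : ℕ} (hE : Module.finrank ℝ E = e + 1) (w : E) (hw : w ≠ 0) :
    ∃ b : OrthonormalBasis (Fin (e + 1)) ℝ E, ‖w‖ • b 0 = w := by
  have : FiniteDimensional ℝ E := Module.finite_of_finrank_eq_succ hE
  have hn : ‖w‖ ≠ 0 := norm_ne_zero_iff.2 hw
  have ho : Orthonormal ℝ (({0} : Set (Fin (e + 1))).domRestrict fun _ => ‖w‖⁻¹ • w) := by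
    refine ⟨fun i => ?_, fun i j hij => (hij (Subsingleton.elim i j)).elim⟩
    simp [norm_smul, hn]
  obtain ⟨b, hb⟩ := ho.exists_orthonormalBasis_extension_of_card_eq (by simpa using hE)
  refine ⟨b, ?_⟩
  rw [hb 0 rfl, smul_smul, mul_inv_cancel₀ hn, one_smul]

/-- In a suitable orthonormal basis of the range of `A`, given by the rows of `B`, whose first
vector is parallel to `A (Aᵀ A)⁻¹ g`, the error depends only on the first column of the inverse
Gram matrix of the sketched basis vectors. -/
theorem exists_directionError_eq {n e : ℕ} {A : Matrix (Fin n) (Fin (e + 1)) ℝ}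
    (hA : A.rank = e + 1) {g : Fin (e + 1) → ℝ} (hg : g ≠ 0) :
    ∃ (B : Matrix (Fin (e + 1)) (Fin n) ℝ) (c : ℝ), B * Bᵀ = 1 ∧ c ≠ 0 ∧
      ∀ (m : ℕ) (S : Matrix (Fin m) (Fin n) ℝ) (α : ℝ),
        directionError A g S α = WithLp.toLp 2 (Bᵀ *ᵥ (c • (α •
          ((gram fun j => S *ᵥ B j)⁻¹ *ᵥ Pi.single 0 1) - Pi.single 0 1))) := by
  let K : Submodule ℝ (EuclideanSpace ℝ (Fin n)) :=
    (LinearMap.range A.mulVecLin).map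
      (WithLp.linearEquiv 2 ℝ (Fin n → ℝ)).symm.toLinearMap
  have hK : Module.finrank ℝ K = e + 1 := by
    rw [LinearEquiv.finrank_map_eq (WithLp.linearEquiv 2 ℝ (Fin n → ℝ)).symm]
    exact hA
  have hmem (y : Fin (e + 1) → ℝ) : WithLp.toLp 2 (A *ᵥ y) ∈ K :=
    ⟨A *ᵥ y, ⟨y, rfl⟩, rfl⟩
  have hAA : IsUnit (Aᵀ * A).det := by
    rw [← Matrix.isUnit_iff_isUnit_det, ← Matrix.mulVec_injective_iff_isUnit]
    have hinj : Function.Injective A.mulVecLin := by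
      rw [← LinearMap.ker_eq_bot, ← Submodule.finrank_eq_zero]
      have h1 := A.mulVecLin.finrank_range_add_finrank_ker
      rw [Module.finrank_fin_fun] at h1
      have h2 : Module.finrank ℝ (LinearMap.range A.mulVecLin) = e + 1 := hA
      omega
    have hker : ∀ y, (Aᵀ * A) *ᵥ y = 0 → y = 0 := by
      intro y hy
      rw [← Matrix.conjTranspose_eq_transpose_of_trivial,
        Matrix.conjTranspose_mul_self_mulVec_eq_zero] at hy
      exact hinj (by simpa using hy)
    exact (injective_iff_map_eq_zero (Aᵀ * A).mulVecLin).2 hker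
  let w : K := ⟨WithLp.toLp 2 (A *ᵥ ((Aᵀ * A)⁻¹ *ᵥ g)), hmem _⟩
  have hw : w ≠ 0 := by
    intro h
    have h1 : A *ᵥ ((Aᵀ * A)⁻¹ *ᵥ g) = 0 := congrArg (fun y : K => y.1.ofLp) h
    have h2 := congrArg (fun y => Aᵀ *ᵥ y) h1
    simp only [Matrix.mulVec_mulVec, Matrix.mulVec_zero] at h2
    rw [← Matrix.mul_assoc, Matrix.mul_nonsing_inv _ hAA, Matrix.one_mulVec] at h2
    exact hg h2
  obtain ⟨b, hb⟩ := exists_orthonormalBasis_zero_eq_smul hK w hw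
  set B := basisRows b with hBdef
  have hB : B * Bᵀ = 1 := basisRows_mul_transpose b
  have hBw : B *ᵥ (A *ᵥ ((Aᵀ * A)⁻¹ *ᵥ g)) = ‖w‖ • Pi.single 0 1 := by
    ext j
    have h := basisRows_mulVec b w j
    rw [← Submodule.coe_inner, ← hb, inner_smul_right, b.inner_eq_ite] at h
    refine Eq.trans ?_ (h.trans ?_)
    · rw [hb]
    · simp [Pi.single_apply]
  have hBA : A = Bᵀ * (B * A) := by
    refine Matrix.ext_of_mulVec_single fun j => ?_
    have h := transpose_basisRows_mulVec b (hmem (Pi.single j 1))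
    rw [← Matrix.mulVec_mulVec, ← Matrix.mulVec_mulVec]
    exact h.symm
  set R := B * A with hR
  clear_value R
  have hAR : Aᵀ * A = Rᵀ * R := by
    rw [hBA, Matrix.transpose_mul, Matrix.transpose_transpose, Matrix.mul_assoc,
      ← Matrix.mul_assoc B, hB, Matrix.one_mul]
  have hRu : IsUnit R.det := by
    rw [hAR, Matrix.det_mul] at hAA
    exact isUnit_of_mul_isUnit_right hAA
  have hRg : Rᵀ⁻¹ *ᵥ g = ‖w‖ • Pi.single 0 1 := by
    rw [← hBw, hAR, Matrix.mul_inv_rev, Matrix.mulVec_mulVec, Matrix.mulVec_mulVec, ← hR,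
      ← Matrix.mul_assoc, Matrix.mul_nonsing_inv _ hRu, Matrix.one_mul]
  refine ⟨B, ‖w‖, hB, norm_ne_zero_iff.2 hw, fun m S α => ?_⟩
  have hG : Aᵀ * Sᵀ * S * A = Rᵀ * gram (fun j => S *ᵥ B j) * R := by
    have : Matrix.of (fun j => S *ᵥ B j) = B * Sᵀ := by
      ext j i
      exact dotProduct_comm (S i) (B j)
    rw [gram, this, Matrix.transpose_mul, Matrix.transpose_transpose]
    conv_lhs => rw [hBA]
    rw [Matrix.transpose_mul, Matrix.transpose_transpose]
    simp only [Matrix.mul_assoc]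
  have hARi : A * R⁻¹ = Bᵀ := by
    rw [hBA, Matrix.mul_assoc, Matrix.mul_nonsing_inv _ hRu, Matrix.mul_one]
  have h1 : A *ᵥ ((Aᵀ * A)⁻¹ *ᵥ g) = Bᵀ *ᵥ (‖w‖ • Pi.single 0 1) := by
    rw [← hRg, hAR, Matrix.mul_inv_rev, ← Matrix.mulVec_mulVec, Matrix.mulVec_mulVec _ A, hARi]
  have h2 : A *ᵥ ((Aᵀ * Sᵀ * S * A)⁻¹ *ᵥ g)
      = Bᵀ *ᵥ ((gram fun j => S *ᵥ B j)⁻¹ *ᵥ (‖w‖ • Pi.single 0 1)) := by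
    rw [← hRg, hG, Matrix.mul_inv_rev, Matrix.mul_inv_rev, ← Matrix.mulVec_mulVec,
      Matrix.mulVec_mulVec _ A, hARi, ← Matrix.mulVec_mulVec]
  rw [directionError, sketchedDirection, newtonDirection, Matrix.mulVec_sub, Matrix.mulVec_smul,
    h1, h2, ← Matrix.mulVec_smul, ← Matrix.mulVec_sub, Matrix.mulVec_smul _ ‖w‖, smul_sub,
    smul_comm α]

/-! ### Bias and variance of the sketched direction -/

theorem directionError_zero {m n d : ℕ} (A : Matrix (Fin n) (Fin d) ℝ)
    (S : Matrix (Fin m) (Fin n) ℝ) (α : ℝ) : directionError A 0 S α = 0 := by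
  simp [directionError, sketchedDirection, newtonDirection]

/-- The law of the error: a random linear combination of orthonormal vectors `q i`, with the first
column of the inverse Gram matrix of i.i.d. Gaussian vectors as coefficients. -/
theorem exists_law_directionError {Ω : Type*} [MeasurableSpace Ω] {P : Measure Ω}
    [IsProbabilityMeasure P] {m n e : ℕ} {S : Ω → Matrix (Fin m) (Fin n) ℝ}
    (hS : IsGaussianSketch S P) {A : Matrix (Fin n) (Fin (e + 1)) ℝ} (hA : A.rank = e + 1)
    {g : Fin (e + 1) → ℝ} (hg : g ≠ 0) :
    ∃ (Y : Ω → Fin (e + 1) → Fin m → ℝ) (q : Fin (e + 1) → EuclideanSpace ℝ (Fin n)) (c : ℝ),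
      HasLaw Y (gaussianRows (Fin (e + 1)) (Fin m) (1 / m)) P ∧ c ≠ 0 ∧ q 0 ≠ 0 ∧
      (∀ ω α, directionError A g (S ω) α
        = c • (α • ∑ i, (gram (Y ω))⁻¹ i 0 • q i - q 0)) ∧
      ∀ ω α, ‖directionError A g (S ω) α‖ ^ 2
        = c ^ 2 * (α ^ 2 * ∑ i, (gram (Y ω))⁻¹ i 0 ^ 2 - 2 * α * (gram (Y ω))⁻¹ 0 0 + 1) := by
  obtain ⟨B, c, hB, hc, h⟩ := exists_directionError_eq hA hg
  have hBT (y : Fin (e + 1) → ℝ) :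
      WithLp.toLp 2 (Bᵀ *ᵥ y) = ∑ i, y i • (WithLp.toLp 2 (B i) : EuclideanSpace ℝ (Fin n)) := by
    ext a
    simp [Matrix.mulVec, dotProduct, mul_comm]
  have hnorm (y : Fin (e + 1) → ℝ) :
      ‖(WithLp.toLp 2 (Bᵀ *ᵥ y) : EuclideanSpace ℝ (Fin n))‖ ^ 2 = y ⬝ᵥ y := by
    rw [EuclideanSpace.real_norm_sq_eq]
    have : (Bᵀ *ᵥ y) ⬝ᵥ (Bᵀ *ᵥ y) = y ⬝ᵥ y := by
      rw [Matrix.dotProduct_mulVec, Matrix.vecMul_mulVec, Matrix.transpose_transpose, hB,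
        Matrix.vecMul_one]
    rw [← this, dotProduct]
    exact Finset.sum_congr rfl fun i _ => pow_two _
  refine ⟨fun ω j => S ω *ᵥ B j, fun i => WithLp.toLp 2 (B i), c, hS.hasLaw_mulVec hB, hc,
    fun h0 => ?_, fun ω α => ?_, fun ω α => ?_⟩
  · have h1 : B 0 ⬝ᵥ B 0 = (1 : Matrix (Fin (e + 1)) (Fin (e + 1)) ℝ) 0 0 := by rw [← hB]; rfl
    have h2 : B 0 = 0 := congrArg WithLp.ofLp h0
    simp [h2] at h1
  · rw [h, hBT]
    simp [sub_smul, mul_smul, smul_sub, Finset.sum_sub_distrib, ← Finset.smul_sum, Pi.single_apply]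
  · rw [h, hnorm]
    simp only [smul_dotProduct, dotProduct_smul, sub_dotProduct, dotProduct_sub, smul_eq_mul,
      Matrix.mulVec_single_one, dotProduct_single, single_dotProduct, Matrix.col_apply,
      Pi.single_eq_same, Pi.smul_apply, Pi.sub_apply]
    rw [dotProduct]
    simp only [Matrix.col_apply, ← pow_two]
    ring

section

variable {Ω : Type*} [MeasurableSpace Ω] {P : Measure Ω} {m d : ℕ}
  {Y : Ω → Fin d → Fin m → ℝ} {v : ℝ≥0}

theorem integrable_inv_gram_comp (hv : v ≠ 0) (hd : d + 1 < m)
    (hY : HasLaw Y (gaussianRows (Fin d) (Fin m) v) P) (i j : Fin d) :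
    Integrable (fun ω => (gram (Y ω))⁻¹ i j) P := by
  have h := integrable_inv_gram hv hd i j
  rw [← hY.map_eq] at h
  exact h.comp_aemeasurable hY.aemeasurable

theorem integral_inv_gram_comp (hv : v ≠ 0) (hd : d + 1 < m)
    (hY : HasLaw Y (gaussianRows (Fin d) (Fin m) v) P) (i j : Fin d) :
    ∫ ω, (gram (Y ω))⁻¹ i j ∂P = if i = j then 1 / (v * (m - d - 1) : ℝ) else 0 := by
  have h := hY.integral_comp (measurable_inv_gram i j).aestronglyMeasurable
  refine h.trans ?_
  split_ifs with hij
  · subst hij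
    exact integral_inv_gram_diag hv hd i
  · exact integral_inv_gram_off_diag v hij

end

theorem integrable_sum_inv_gram_sq {v : ℝ≥0} (hv : v ≠ 0) {e m : ℕ} (he : e + 4 < m)
    (p : Fin (e + 1)) :
    Integrable (fun Y => ∑ i, (gram Y)⁻¹ i p ^ 2) (gaussianRows (Fin (e + 1)) (Fin m) v) := by
  refine ⟨(Finset.measurable_fun_sum _ fun i _ =>
    (measurable_inv_gram i p).pow_const 2).aestronglyMeasurable, ?_⟩
  rw [hasFiniteIntegral_iff_ofReal (ae_of_all _ fun Y => Finset.sum_nonneg fun _ _ => sq_nonneg _),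
    lintegral_sum_inv_gram_sq hv he p]
  exact ENNReal.ofReal_lt_top

theorem integral_sum_inv_gram_sq {v : ℝ≥0} (hv : v ≠ 0) {e m : ℕ} (he : e + 4 < m)
    (p : Fin (e + 1)) :
    ∫ Y, ∑ i, (gram Y)⁻¹ i p ^ 2 ∂gaussianRows (Fin (e + 1)) (Fin m) v
      = (m - 1) / (v ^ 2 * ((m - e - 1) * (m - e - 2) * (m - e - 4))) := by
  have hem : (e : ℝ) + 4 < m := by exact_mod_cast he
  rw [integral_eq_lintegral_of_nonneg_ae (ae_of_all _ fun Y =>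
      Finset.sum_nonneg fun _ _ => sq_nonneg _) (integrable_sum_inv_gram_sq hv he p).1,
    lintegral_sum_inv_gram_sq hv he p, ENNReal.toReal_ofReal]
  have h0 : 0 < (m : ℝ) - 1 := by linarith [(Nat.cast_nonneg e : (0 : ℝ) ≤ e)]
  have h1 : 0 < (m : ℝ) - e - 1 := by linarith
  have h2 : 0 < (m : ℝ) - e - 2 := by linarith
  have h4 : 0 < (m : ℝ) - e - 4 := by linarith
  positivity

theorem theta1_pos {m d : ℕ} (h : d + 1 < m) : 0 < theta1 m d := by
  have h' : (d : ℝ) + 1 < m := by exact_mod_cast h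
  have h1 : 0 < (m : ℝ) - d - 1 := by linarith
  have hm : 0 < (m : ℝ) := by exact_mod_cast (by omega : 0 < m)
  unfold theta1
  positivity

theorem theta2_pos {m d : ℕ} (h : d + 3 < m) : 0 < theta2 m d := by
  have h' : (d : ℝ) + 3 < m := by exact_mod_cast h
  have hm : (1 : ℝ) < m := by exact_mod_cast (by omega : 1 < m)
  have h0 : 0 < (m : ℝ) - 1 := by linarith
  have h1 : 0 < (m : ℝ) - d - 1 := by linarith
  have h2 : 0 < (m : ℝ) - d := by linarith
  have h3 : 0 < (m : ℝ) - d - 3 := by linarith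
  unfold theta2
  positivity

section

variable {Ω : Type*} [MeasurableSpace Ω] {P : Measure Ω} [IsProbabilityMeasure P]
  {m n e : ℕ} {S : Ω → Matrix (Fin m) (Fin n) ℝ} {A : Matrix (Fin n) (Fin (e + 1)) ℝ}
  {g : Fin (e + 1) → ℝ}

/-- The bias is a multiple of the first basis vector, the off-diagonal means being zero. -/
theorem bias_eq (hS : IsGaussianSketch S P) (hA : A.rank = e + 1) (hg : g ≠ 0)
    (hm : e + 1 + 1 < m) :
    (∀ α, Integrable (fun ω => directionError A g (S ω) α) P) ∧
    ∃ u : EuclideanSpace ℝ (Fin n), u ≠ 0 ∧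
      ∀ α, bias P S A g α = (α * theta1 m (e + 1) - 1) • u := by
  obtain ⟨Y, q, c, hY, hc, hq, herr, -⟩ := exists_law_directionError hS hA hg
  have hm0 : (m : ℝ) ≠ 0 := by exact_mod_cast (by omega : m ≠ 0)
  have hv : (1 / m : ℝ≥0) ≠ 0 := by
    have : (m : ℝ≥0) ≠ 0 := by exact_mod_cast (by omega : m ≠ 0)
    positivity
  have hi (i : Fin (e + 1)) : Integrable (fun ω => (gram (Y ω))⁻¹ i 0 • q i) P :=
    (integrable_inv_gram_comp hv hm hY i 0).smul_const _
  have hs : Integrable (fun ω => ∑ i, (gram (Y ω))⁻¹ i 0 • q i) P :=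
    integrable_finsetSum _ fun i _ => hi i
  refine ⟨fun α => ?_, c • q 0, smul_ne_zero hc hq, fun α => ?_⟩
  · simp_rw [herr]
    exact ((hs.smul α).sub (integrable_const _)).smul c
  · simp_rw [bias, herr]
    rw [integral_smul, integral_sub (by exact hs.smul α) (integrable_const _), integral_smul,
      integral_finsetSum _ fun i _ => hi i]
    simp_rw [integral_smul_const, integral_inv_gram_comp hv hm hY]
    have h1 : 1 / (((1 / m : ℝ≥0) : ℝ) * (m - (e + 1 : ℕ) - 1)) = theta1 m (e + 1) := by
      rw [theta1]
      push_cast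
      field_simp
    simp only [h1, ite_smul, zero_smul, Finset.sum_ite_eq', Finset.mem_univ, if_true,
      integral_const, probReal_univ, one_smul]
    module

theorem errorVariance_eq (hS : IsGaussianSketch S P) (hA : A.rank = e + 1) (hg : g ≠ 0)
    (hm : e + 1 + 3 < m) :
    (∀ α, Integrable (fun ω => ‖directionError A g (S ω) α‖ ^ 2) P) ∧
    ∃ c : ℝ, 0 < c ∧ ∀ α, errorVariance P S A g α
      = c * (α ^ 2 * theta2 m (e + 1) - 2 * α * theta1 m (e + 1) + 1) := by
  obtain ⟨Y, q, c, hY, hc, hq, -, herr⟩ := exists_law_directionError hS hA hg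
  have hm0 : (m : ℝ) ≠ 0 := by exact_mod_cast (by omega : m ≠ 0)
  have hv : (1 / m : ℝ≥0) ≠ 0 := by
    have : (m : ℝ≥0) ≠ 0 := by exact_mod_cast (by omega : m ≠ 0)
    positivity
  have h0 := integrable_inv_gram_comp hv (by omega) hY 0 0
  have hs : Integrable (fun ω => ∑ i, (gram (Y ω))⁻¹ i 0 ^ 2) P := by
    have h := integrable_sum_inv_gram_sq hv (by omega : e + 4 < m) 0
    rw [← hY.map_eq] at h
    exact h.comp_aemeasurable hY.aemeasurable
  have hs' := hY.integral_comp (integrable_sum_inv_gram_sq hv (by omega : e + 4 < m) 0).1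
  rw [integral_sum_inv_gram_sq hv (by omega : e + 4 < m) 0] at hs'
  simp only [Function.comp_def] at hs'
  have hd (α : ℝ) : Integrable (fun ω => α ^ 2 * ∑ i, (gram (Y ω))⁻¹ i 0 ^ 2
      - 2 * α * (gram (Y ω))⁻¹ 0 0) P := (hs.const_mul _).sub (h0.const_mul _)
  refine ⟨fun α => ?_, c ^ 2, by positivity, fun α => ?_⟩
  · simp_rw [herr]
    exact ((hd α).add (integrable_const _)).const_mul _
  · simp_rw [errorVariance, herr]
    rw [integral_const_mul, integral_add (hd α) (integrable_const _),
      integral_sub (hs.const_mul _) (h0.const_mul _), integral_const_mul, integral_const_mul,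
      integral_inv_gram_comp hv (by omega) hY, hs', if_pos rfl, integral_const, probReal_univ,
      one_smul, theta1, theta2]
    push_cast
    rw [show (m : ℝ) - (e + 1) = m - e - 1 by ring, show (m : ℝ) - e - 1 - 1 = m - e - 2 by ring,
      show (m : ℝ) - e - 1 - 3 = m - e - 4 by ring]
    congr 4
    · field_simp
    · field_simp

end

/-- Completing the square. -/
theorem quadratic_eq_add_sq {t₁ t₂ : ℝ} (ht : t₂ ≠ 0) (c α : ℝ) :
    c * (α ^ 2 * t₂ - 2 * α * t₁ + 1)
      = c * ((t₁ / t₂) ^ 2 * t₂ - 2 * (t₁ / t₂) * t₁ + 1) + c * t₂ * (α - t₁ / t₂) ^ 2 := by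
  field_simp
  ring

end NewtonSketch


theorem mainTheorem10 {Ω : Type*} [MeasurableSpace Ω] (P : Measure Ω) [IsProbabilityMeasure P]
    (m n d : ℕ) (S : Ω → Matrix (Fin m) (Fin n) ℝ) (hS : NewtonSketch.IsGaussianSketch S P)
    (A : Matrix (Fin n) (Fin d) ℝ) (hA : A.rank = d) (g : Fin d → ℝ) :
    (d + 1 < m →
      (∀ α : ℝ, Integrable (fun ω => NewtonSketch.directionError A g (S ω) α) P) ∧
      NewtonSketch.bias P S A g (1 / NewtonSketch.theta1 m d) = 0 ∧
      (g ≠ 0 → ∀ α : ℝ,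
        NewtonSketch.bias P S A g α = 0 ↔ α = 1 / NewtonSketch.theta1 m d)) ∧
    (d + 3 < m →
      (∀ α : ℝ, Integrable (fun ω => ‖NewtonSketch.directionError A g (S ω) α‖ ^ 2) P) ∧
      (∀ α : ℝ, NewtonSketch.errorVariance P S A g
          (NewtonSketch.theta1 m d / NewtonSketch.theta2 m d) ≤
        NewtonSketch.errorVariance P S A g α) ∧
      (g ≠ 0 → ∀ α : ℝ,
        (∀ β : ℝ, NewtonSketch.errorVariance P S A g α ≤ NewtonSketch.errorVariance P S A g β) ↔
          α = NewtonSketch.theta1 m d / NewtonSketch.theta2 m d)) := by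
  by_cases hg : g = 0
  · subst hg
    simp [NewtonSketch.bias, NewtonSketch.errorVariance, NewtonSketch.directionError_zero]
  obtain _ | e := d
  -- In dimension `0` the vector `g` is zero.
  · exact absurd (Subsingleton.elim g 0) hg
  refine ⟨fun hm => ?_, fun hm => ?_⟩
  · obtain ⟨hint, u, hu, hb⟩ := NewtonSketch.bias_eq hS hA hg hm
    have ht := NewtonSketch.theta1_pos hm
    have key (α : ℝ) : NewtonSketch.bias P S A g α = 0 ↔ α = 1 / NewtonSketch.theta1 m (e + 1) := by
      rw [hb, smul_eq_zero, or_iff_left hu, sub_eq_zero, eq_div_iff ht.ne']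
    exact ⟨hint, (key _).2 rfl, fun _ => key⟩
  · obtain ⟨hint, c, hc, hV⟩ := NewtonSketch.errorVariance_eq hS hA hg hm
    have ht := NewtonSketch.theta2_pos hm
    have hquad := NewtonSketch.quadratic_eq_add_sq (t₁ := NewtonSketch.theta1 m (e + 1)) ht.ne' c
    have hmin (α : ℝ) : NewtonSketch.errorVariance P S A g
        (NewtonSketch.theta1 m (e + 1) / NewtonSketch.theta2 m (e + 1)) ≤
          NewtonSketch.errorVariance P S A g α := by
      rw [hV, hV, hquad α]
      exact le_add_of_nonneg_right (by positivity)
    refine ⟨hint, hmin, fun _ α => ⟨fun h => ?_, fun h => h ▸ hmin⟩⟩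
    have h1 := h (NewtonSketch.theta1 m (e + 1) / NewtonSketch.theta2 m (e + 1))
    rw [hV, hV, hquad α, add_le_iff_nonpos_right] at h1
    have h2 : (α - NewtonSketch.theta1 m (e + 1) / NewtonSketch.theta2 m (e + 1)) ^ 2 ≤ 0 :=
      nonpos_of_mul_nonpos_right h1 (by positivity)
    exact sub_eq_zero.1 (pow_eq_zero_iff two_ne_zero |>.1 (le_antisymm h2 (sq_nonneg _)))
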